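/- Let $K$ and $K'$ be compact convex subsets of (real, Hausdorff) locally convex spaces. Let $A(K)$ be the set of continuous affine functions $K\to\mathbb{R}$, let $A_c(K)=\{f\in A(K): f(x)>0 \text{ for all } x\in K\}$ with the pointwise order, let $m(f,g)=\sup\{\lambda>0:\lambda g\le f\}$ for $f,g\in A_c(K)$, and let $\partial_e K$ be the set of extreme points of $K$; similarly for $K'$. A bijection $\Phi:A_c(K)\to A_c(K')$ is called gauge-preserving if $m(\Phi(f),\Phi(g))=m(f,g)$ for all $f,g\in A_c(K)$. The following statements are equivalent: (i) There exists a gauge-preserving bijection $\Phi:A_c(K)\to A_c(K')$ such that $\Phi(\mathbb{1}_K)=\mathbb{1}_{K'}$. (ii) There exists a bijection $\alpha:\partial_e K\to\partial_e K'$ such that for every $f\in A_c(K)$ and $g\in A_c(K')$ the functions $g\circ\alpha$ on $\partial_e K$ and $f\circ\alpha^{-1}$ on $\partial_e K'$ are continuous and extend to continuous affine functions on $K$ and $K'$, respectively. Moreover, for every $\Phi$ as in (i) there is an $\alpha$ as in (ii) such that $$\Phi(f)|_{\partial_e K'}=f\circ\alpha^{-1}\ \text{ for every } f\in A_c(K),\qquad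 \Phi^{-1}(g)|_{\partial_e K}=g\circ\alpha\ \text{ for every } g\in A_c(K'),$$ and conversely for every $\alpha$ as in (ii) there is exactly one $\Phi$ as in (i) that satisfies these two formulas. -/

import Mathlib

/-! `A(K)`, the cone `A_c(K)`, the gauge function and gauge-preserving bijections for a
compact convex subset `K` of a real topological vector space. -/

noncomputable section

namespace GaugeCone

section

variable {E : Type*} [AddCommGroup E] [Module ℝ E]

/-- A real function on the set `K` is affine if it respects the convex combinations
of two points of `K` that lie in `K` (for convex `K`: all of them). -/
def IsAffine (K : Set E) (f : K → ℝ) : Prop :=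
  ∀ (x y z : K) (a b : ℝ), 0 ≤ a → 0 ≤ b → a + b = 1 →
    (z : E) = a • (x : E) + b • (y : E) → f z = a * f x + b * f y

/-- `A(K)`: the continuous affine real functions on `K`. -/
def A [TopologicalSpace E] (K : Set E) : Set (K → ℝ) :=
  {f | Continuous f ∧ IsAffine K f}

/-- `A_c(K)`: the elements of `A(K)` with values in `(0, ∞)`. -/
def Ac [TopologicalSpace E] (K : Set E) : Set (K → ℝ) :=
  {f | f ∈ A K ∧ ∀ x, 0 < f x}

/-- The constant function `1` as an element of `A_c(K)`. -/
def Ac.one [TopologicalSpace E] (K : Set E) : Ac K :=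
  ⟨fun _ => 1, ⟨continuous_const, fun _ _ _ a b _ _ hab _ => by simp [hab]⟩,
    fun _ => one_pos⟩

/-- The gauge function `m(f, g) = sup {t > 0 : t g ≤ f}`, with the pointwise order. -/
def gauge_m [TopologicalSpace E] {K : Set E} (f g : Ac K) : ℝ :=
  sSup {t : ℝ | 0 < t ∧ t • (g : K → ℝ) ≤ (f : K → ℝ)}

/-- The extreme boundary `∂ₑK`, with the topology induced from the ambient space. -/
abbrev ExtBdry (K : Set E) : Type _ := K.extremePoints ℝ

/-- The restriction to `∂ₑK` of a function on `K`. -/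
def restr (K : Set E) (f : K → ℝ) : ExtBdry K → ℝ :=
  fun x => f ⟨x, extremePoints_subset x.2⟩

/-- A function on `∂ₑK` is continuous and extends to a continuous affine function on `K`. -/
def ContinuousAndExtends [TopologicalSpace E] (K : Set E) (u : ExtBdry K → ℝ) : Prop :=
  Continuous u ∧ ∃ h ∈ A K, restr K h = u

end

section

variable {E E' : Type*} [AddCommGroup E] [Module ℝ E] [TopologicalSpace E]
  [AddCommGroup E'] [Module ℝ E'] [TopologicalSpace E']

/-- A bijection `A_c(K) → A_c(K')` is gauge-preserving if `m(Φ f, Φ g) = m(f, g)`. -/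
def IsGaugePreserving {K : Set E} {K' : Set E'} (Φ : Ac K ≃ Ac K') : Prop :=
  ∀ f g : Ac K, gauge_m (Φ f) (Φ g) = gauge_m f g

/-- `Φ` is a gauge-preserving bijection with `Φ(1) = 1`. -/
def IsUnitalGaugePreserving {K : Set E} {K' : Set E'} (Φ : Ac K ≃ Ac K') : Prop :=
  IsGaugePreserving Φ ∧ Φ (Ac.one K) = Ac.one K'

/-- The functions `g ∘ α` and `f ∘ α⁻¹`, for `g ∈ A_c(K')` and `f ∈ A_c(K)`, are continuous
and extend to continuous affine functions on `K` and `K'` respectively. -/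
def IsAdmissible {K : Set E} {K' : Set E'} (α : ExtBdry K ≃ ExtBdry K') : Prop :=
  ∀ (f : Ac K) (g : Ac K'),
    ContinuousAndExtends K (restr K' (g : K' → ℝ) ∘ α) ∧
    ContinuousAndExtends K' (restr K (f : K → ℝ) ∘ α.symm)

/-- `Φ(f) = f ∘ α⁻¹` on `∂ₑK'` for every `f ∈ A_c(K)`, and `Φ⁻¹(g) = g ∘ α` on `∂ₑK`
for every `g ∈ A_c(K')`. -/
def IsInducedBy {K : Set E} {K' : Set E'} (Φ : Ac K ≃ Ac K')
    (α : ExtBdry K ≃ ExtBdry K') : Prop :=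
  (∀ f : Ac K, restr K' (Φ f : K' → ℝ) = restr K (f : K → ℝ) ∘ α.symm) ∧
  (∀ g : Ac K', restr K (Φ.symm g : K → ℝ) = restr K' (g : K' → ℝ) ∘ α)

end

end GaugeCone

end

namespace GaugeCone

open Set

section

variable {E : Type*} [AddCommGroup E] [Module ℝ E] [TopologicalSpace E] {K : Set E}

/-! The gauge encodes the relations `t g ≤ f`, so a unital gauge-preserving `Φ` is a positively
homogeneous order isomorphism. The crux is additivity (`map_add_le`). At an extreme point, two
functions of equal value have a common affine majorant of almost that value; pulling it back through
`Φ` bounds `Φ (f₁ + f₂)` there, and the minimum principle spreads the bound to all of `K'`. Hence `f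
↦ Φ f x` is additive, so it is evaluation at a point of `K` (`exists_eq_eval`). This yields a
bijection of `K` with `K'` that preserves extreme points. Conversely, continuous affine functions
are determined and ordered by their values on `∂ₑK`, so `α` transports the cone together with its
gauge. -/

theorem const_mem_A (K : Set E) (c : ℝ) : (fun _ : K => c) ∈ A K :=
  ⟨continuous_const, fun _ _ _ a b _ _ hab _ => by rw [← add_mul, hab, one_mul]⟩

theorem add_mem_A {f g : K → ℝ} (hf : f ∈ A K) (hg : g ∈ A K) : f + g ∈ A K :=
  ⟨hf.1.add hg.1, fun x y z a b ha hb hab hz => by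
    simp only [Pi.add_apply, hf.2 x y z a b ha hb hab hz, hg.2 x y z a b ha hb hab hz]; ring⟩

theorem smul_mem_A (t : ℝ) {f : K → ℝ} (hf : f ∈ A K) : t • f ∈ A K :=
  ⟨hf.1.const_smul t, fun x y z a b ha hb hab hz => by
    simp only [Pi.smul_apply, smul_eq_mul, hf.2 x y z a b ha hb hab hz]; ring⟩

theorem sub_mem_A {f g : K → ℝ} (hf : f ∈ A K) (hg : g ∈ A K) : f - g ∈ A K := by
  have h : f - g = f + (-1 : ℝ) • g := by simp [sub_eq_add_neg]
  exact h ▸ add_mem_A hf (smul_mem_A _ hg)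

theorem dual_mem_A (K : Set E) (L : StrongDual ℝ E) : (fun y : K => L y) ∈ A K :=
  ⟨L.continuous.comp continuous_subtype_val, fun x y z a b _ _ _ hz => by
    simp only [hz, map_add, map_smul, smul_eq_mul]⟩

/-- The sum of two elements of `A_c(K)`. -/
noncomputable def Ac.add (f g : Ac K) : Ac K :=
  ⟨(f : K → ℝ) + g, add_mem_A f.2.1 g.2.1, fun x => add_pos (f.2.2 x) (g.2.2 x)⟩

/-- A positive multiple of an element of `A_c(K)`. -/
noncomputable def Ac.smul (t : ℝ) (ht : 0 < t) (f : Ac K) : Ac K :=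
  ⟨t • (f : K → ℝ), smul_mem_A t f.2.1, fun x => mul_pos ht (f.2.2 x)⟩

theorem Ac.add_apply (f g : Ac K) (x : K) : (Ac.add f g : K → ℝ) x = (f : K → ℝ) x + (g : K → ℝ) x :=
  rfl

theorem Ac.smul_apply {t : ℝ} (ht : 0 < t) (f : Ac K) (x : K) :
    (Ac.smul t ht f : K → ℝ) x = t * (f : K → ℝ) x :=
  rfl

theorem Ac.one_apply (x : K) : (Ac.one K : K → ℝ) x = 1 := rfl

/-- A continuous affine function on a compact set becomes positive after adding a constant. -/
theorem exists_Ac_eq_add_const (hK : IsCompact K) {f : K → ℝ} (hf : f ∈ A K) :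
    ∃ (c : ℝ) (F : Ac K), ∀ y, (F : K → ℝ) y = f y + c := by
  have : CompactSpace K := isCompact_iff_compactSpace.mp hK
  obtain ⟨m, hm⟩ := (isCompact_range hf.1).bddBelow
  refine ⟨1 - m, ⟨f + fun _ => 1 - m, add_mem_A hf (const_mem_A K _), fun x => ?_⟩, fun y => rfl⟩
  have := hm (mem_range_self x)
  simp only [Pi.add_apply]
  linarith

theorem Ac.separatesPoints [IsTopologicalAddGroup E] [ContinuousSMul ℝ E] [LocallyConvexSpace ℝ E]
    [T2Space E] (hK : IsCompact K) {x y : K} (h : ∀ f : Ac K, (f : K → ℝ) x = (f : K → ℝ) y) :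
    x = y := by
  by_contra hxy
  obtain ⟨L, hL⟩ := geometric_hahn_banach_point_point (E := E) (fun h => hxy (Subtype.ext h))
  obtain ⟨c, F, hF⟩ := exists_Ac_eq_add_const hK (dual_mem_A K L)
  have := h F
  rw [hF, hF] at this
  linarith

/-! ### The gauge and the scaled order. -/

theorem le_gauge_m_iff [Nonempty K] {t : ℝ} (ht : 0 < t) (f g : Ac K) :
    t ≤ gauge_m f g ↔ t • (g : K → ℝ) ≤ (f : K → ℝ) := by
  have hbdd : BddAbove {t : ℝ | 0 < t ∧ t • (g : K → ℝ) ≤ (f : K → ℝ)} := by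
    obtain ⟨x⟩ := ‹Nonempty K›
    refine ⟨(f : K → ℝ) x / (g : K → ℝ) x, fun s hs => ?_⟩
    rw [le_div_iff₀ (g.2.2 x)]
    exact hs.2 x
  refine ⟨fun h y => ?_, fun h => le_csSup hbdd ⟨ht, h⟩⟩
  have hne : {t : ℝ | 0 < t ∧ t • (g : K → ℝ) ≤ (f : K → ℝ)}.Nonempty := by
    by_contra hne
    rw [not_nonempty_iff_eq_empty] at hne
    rw [gauge_m, hne, Real.sSup_empty] at h
    linarith
  have hle : gauge_m f g ≤ (f : K → ℝ) y / (g : K → ℝ) y :=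
    csSup_le hne fun s hs => by
      rw [le_div_iff₀ (g.2.2 y)]
      exact hs.2 y
  have := h.trans hle
  rwa [le_div_iff₀ (g.2.2 y)] at this

/-- On empty `K` the supremum is over an unbounded set and takes the default value 0, so the gauge
detects emptiness. -/
theorem nonempty_iff_gauge_m_one_pos : Nonempty K ↔ 0 < gauge_m (Ac.one K) (Ac.one K) := by
  refine ⟨fun h => one_pos.trans_le ((le_gauge_m_iff one_pos _ _).2 (by simp)), fun h => ?_⟩
  by_contra hK
  rw [not_nonempty_iff] at hK
  have : {t : ℝ | 0 < t ∧ t • (Ac.one K : K → ℝ) ≤ (Ac.one K : K → ℝ)} = Ioi 0 := by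
    ext t
    simp
  rw [gauge_m, this, Real.sSup_of_not_bddAbove (not_bddAbove_Ioi 0)] at h
  exact lt_irrefl _ h

/-! ### The minimum principle on the extreme boundary. -/

/-- A continuous affine function attains its minimum at an extreme point. -/
theorem exists_extremePoint_isMin [IsTopologicalAddGroup E] [ContinuousSMul ℝ E]
    [LocallyConvexSpace ℝ E] [T2Space E] (hK : IsCompact K) [Nonempty K] {h : K → ℝ}
    (hh : h ∈ A K) : ∃ x : ExtBdry K, ∀ y, restr K h x ≤ h y := by
  have : CompactSpace K := isCompact_iff_compactSpace.mp hK
  obtain ⟨x₀, -, hx₀⟩ := isCompact_univ.exists_isMinOn univ_nonempty hh.1.continuousOn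
  have hmin : ∀ y, h x₀ ≤ h y := fun y => hx₀ (mem_univ y)
  -- The minimisers form a compact face; an extreme point of it is extreme in `K`.
  have hext : IsExtreme ℝ K (Subtype.val '' {y : K | h y = h x₀}) := by
    refine ⟨fun y hy => ?_, fun y hy z hz w hw hwyz => ?_⟩
    · obtain ⟨w, -, rfl⟩ := hy
      exact w.2
    · obtain ⟨w, hw, rfl⟩ := hw
      obtain ⟨a, b, ha, hb, hab, hwab⟩ := hwyz
      have key := hh.2 ⟨y, hy⟩ ⟨z, hz⟩ w a b ha.le hb.le hab hwab.symm
      refine ⟨⟨y, hy⟩, ?_, rfl⟩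
      rw [mem_ofPred_eq] at hw ⊢
      refine le_antisymm ?_ (hmin _)
      have h1 := mul_le_mul_of_nonneg_left (hmin ⟨z, hz⟩) hb.le
      have h2 : a * h ⟨y, hy⟩ ≤ a * h x₀ := by
        rw [hw] at key
        have h3 : a * h x₀ + b * h x₀ = h x₀ := by rw [← add_mul, hab, one_mul]
        linarith
      exact le_of_mul_le_mul_left h2 ha
  have hcomp : IsCompact (Subtype.val '' {y : K | h y = h x₀}) :=
    ((isClosed_eq hh.1 continuous_const).isCompact).image continuous_subtype_val
  obtain ⟨x, hx⟩ := hcomp.extremePoints_nonempty ⟨x₀, x₀, rfl, rfl⟩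
  refine ⟨⟨x, hext.extremePoints_subset_extremePoints hx⟩, fun y => ?_⟩
  obtain ⟨w, hw, rfl⟩ := extremePoints_subset hx
  exact hw.trans_le (hmin y)

theorem le_of_restr_le [IsTopologicalAddGroup E] [ContinuousSMul ℝ E]
    [LocallyConvexSpace ℝ E] [T2Space E] (hK : IsCompact K) {f g : K → ℝ} (hf : f ∈ A K)
    (hg : g ∈ A K) (h : restr K f ≤ restr K g) : f ≤ g := by
  intro y
  have : Nonempty K := ⟨y⟩
  obtain ⟨x, hx⟩ := exists_extremePoint_isMin hK (sub_mem_A hg hf)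
  have h1 := hx y
  have h2 := h x
  simp only [restr, Pi.sub_apply] at h1 h2
  linarith

theorem eq_of_restr_eq [IsTopologicalAddGroup E] [ContinuousSMul ℝ E]
    [LocallyConvexSpace ℝ E] [T2Space E] (hK : IsCompact K) {f g : K → ℝ} (hf : f ∈ A K)
    (hg : g ∈ A K) (h : restr K f = restr K g) : f = g :=
  le_antisymm (le_of_restr_le hK hf hg h.le) (le_of_restr_le hK hg hf h.ge)

theorem pos_of_restr_pos [IsTopologicalAddGroup E] [ContinuousSMul ℝ E]
    [LocallyConvexSpace ℝ E] [T2Space E] (hK : IsCompact K) {f : K → ℝ} (hf : f ∈ A K)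
    (h : ∀ x, 0 < restr K f x) (y : K) : 0 < f y := by
  have : Nonempty K := ⟨y⟩
  obtain ⟨x, hx⟩ := exists_extremePoint_isMin hK hf
  exact (h x).trans_le (hx y)

/-! ### Affine majorants by separation in `E × ℝ`. -/

theorem convex_graph (hKc : Convex ℝ K) {f : K → ℝ} (hf : f ∈ A K) :
    Convex ℝ (range fun y : K => ((y : E), f y)) := by
  rintro _ ⟨y, rfl⟩ _ ⟨z, rfl⟩ a b ha hb hab
  refine ⟨⟨a • (y : E) + b • (z : E), hKc y.2 z.2 ha hb hab⟩, ?_⟩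
  ext1
  · rfl
  · exact hf.2 y z _ a b ha hb hab rfl

theorem isCompact_convexJoin {F : Type*} [AddCommGroup F] [Module ℝ F] [TopologicalSpace F]
    [IsTopologicalAddGroup F] [ContinuousSMul ℝ F] {s t : Set F} (hs : IsCompact s)
    (ht : IsCompact t) : IsCompact (convexJoin ℝ s t) := by
  have h : convexJoin ℝ s t =
      (fun p : ℝ × F × F => (1 - p.1) • p.2.1 + p.1 • p.2.2) '' (Icc 0 1 ×ˢ s ×ˢ t) := by
    ext w
    simp only [mem_convexJoin, segment_eq_image, mem_image, mem_prod, Prod.exists]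
    constructor
    · rintro ⟨x, hx, y, hy, r, hr, rfl⟩
      exact ⟨r, x, y, ⟨hr, hx, hy⟩, rfl⟩
    · rintro ⟨r, x, y, ⟨hr, hx, hy⟩, rfl⟩
      exact ⟨x, hx, y, hy, r, hr, rfl⟩
  rw [h]
  exact (isCompact_Icc.prod (hs.prod ht)).image (by fun_prop)

/-- At an extreme point, the upper affine envelope of the maximum of two continuous affine
functions agrees with that maximum. -/
theorem exists_A_ge_of_mem_extremePoints [IsTopologicalAddGroup E] [ContinuousSMul ℝ E]
    [LocallyConvexSpace ℝ E] [T2Space E] (hK : IsCompact K) (hKc : Convex ℝ K) {f₁ f₂ : K → ℝ}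
    (hf₁ : f₁ ∈ A K) (hf₂ : f₂ ∈ A K) (x : ExtBdry K) {v c : ℝ} (h₁ : restr K f₁ x = v)
    (h₂ : restr K f₂ x = v) (hc : v < c) :
    ∃ g ∈ A K, f₁ ≤ g ∧ f₂ ≤ g ∧ restr K g x = c := by
  have : CompactSpace K := isCompact_iff_compactSpace.mp hK
  set C := convexJoin ℝ (range fun y : K => ((y : E), f₁ y)) (range fun y : K => ((y : E), f₂ y))
    with hC
  let x' : K := ⟨x, extremePoints_subset x.2⟩
  have hCcomp : IsCompact C := isCompact_convexJoin
    (isCompact_range (continuous_subtype_val.prodMk hf₁.1))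
    (isCompact_range (continuous_subtype_val.prodMk hf₂.1))
  have hCconv : Convex ℝ C := (convex_graph hKc hf₁).convexJoin (convex_graph hKc hf₂)
  have hmem₁ : ∀ y : K, ((y : E), f₁ y) ∈ C := fun y =>
    mem_convexJoin.2 ⟨_, mem_range_self y, _, mem_range_self y, left_mem_segment _ _ _⟩
  have hmem₂ : ∀ y : K, ((y : E), f₂ y) ∈ C := fun y =>
    mem_convexJoin.2 ⟨_, mem_range_self y, _, mem_range_self y, right_mem_segment _ _ _⟩
  -- Since `x` is extreme, a point of `C` above it combines only `(x, v)` with itself.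
  have hnot : ((x : E), c) ∉ C := by
    intro hx
    obtain ⟨_, ⟨y, rfl⟩, _, ⟨z, rfl⟩, a, b, ha, hb, hab, heq⟩ := mem_convexJoin.1 hx
    have hE : a • (y : E) + b • (z : E) = x := congrArg Prod.fst heq
    have hR : a * f₁ y + b * f₂ z = c := congrArg Prod.snd heq
    have h₁' : f₁ x' = v := h₁
    have h₂' : f₂ x' = v := h₂
    rcases ha.eq_or_lt with rfl | ha
    · have hb1 : b = 1 := by linarith
      have hz : z = x' := Subtype.ext (by simpa [hb1] using hE)
      rw [hz, h₂', hb1] at hR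
      linarith
    rcases hb.eq_or_lt with rfl | hb
    · have ha1 : a = 1 := by linarith
      have hy : y = x' := Subtype.ext (by simpa [ha1] using hE)
      rw [hy, h₁', ha1] at hR
      linarith
    obtain ⟨hy, hz⟩ := (mem_extremePoints.1 x.2).2 y y.2 z z.2 ⟨a, b, ha, hb, hab, hE⟩
    have hy : y = x' := Subtype.ext hy
    have hz : z = x' := Subtype.ext hz
    rw [hy, hz, h₁', h₂', ← add_mul, hab] at hR
    linarith
  obtain ⟨L, u, hLC, hLx⟩ := geometric_hahn_banach_closed_point hCconv hCcomp.isClosed hnot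
  have hsplit : ∀ (y : E) (t : ℝ), L (y, t) = L (y, 0) + t * L (0, 1) := by
    intro y t
    have : ((y, t) : E × ℝ) = (y, 0) + t • (0, 1) := by simp
    rw [this, map_add, map_smul, smul_eq_mul]
  set s := L (0, 1) with hs
  -- `(x, v) ∈ C` lies below `(x, c)`, so the hyperplane `L = L (x, c)` is not vertical: it is the
  -- graph of the required function.
  have hspos : 0 < s := by
    have h := (hLC _ (hmem₁ x')).trans hLx
    rw [hsplit, hsplit (x : E) c] at h
    have h₁' : f₁ x' = v := h₁
    rw [h₁'] at h
    have : 0 < (c - v) * s := by linarith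
    exact pos_of_mul_pos_right this (by linarith)
  have hmain : ∀ (y : K) (t : ℝ), ((y : E), t) ∈ C →
      t ≤ c + s⁻¹ * (L ((x : E), 0) - L ((y : E), 0)) := by
    intro y t ht
    have h := (hLC _ ht).trans hLx
    rw [hsplit, hsplit (x : E) c] at h
    have h' : t * s ≤ (c + s⁻¹ * (L ((x : E), 0) - L ((y : E), 0))) * s := by
      have : (c + s⁻¹ * (L ((x : E), 0) - L ((y : E), 0))) * s =
          c * s + (L ((x : E), 0) - L ((y : E), 0)) := by
        field_simp
      rw [this]
      linarith
    exact le_of_mul_le_mul_right h' hspos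
  refine ⟨fun y => c + s⁻¹ * (L ((x : E), 0) - L ((y : E), 0)), ?_, fun y => hmain y _ (hmem₁ y),
    fun y => hmain y _ (hmem₂ y), by simp [restr]⟩
  exact add_mem_A (const_mem_A K c) (smul_mem_A s⁻¹ (sub_mem_A (const_mem_A K (L ((x : E), 0)))
    (dual_mem_A K (L.comp (ContinuousLinearMap.inl ℝ E ℝ)))))

/-! ### Functionals on the cone as point evaluations. -/

theorem exists_Ac_eq_const_add_sum {p : Ac K → ℝ}
    (hadd : ∀ f g, p (Ac.add f g) = p f + p g)
    (hsmul : ∀ t ht f, p (Ac.smul t ht f) = t * p f) (hone : p (Ac.one K) = 1)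
    {ι : Type*} (s : Finset ι) (f : ι → Ac K) {a : ι → ℝ} (ha : ∀ i, 0 < a i) {c : ℝ}
    (hc : 0 < c) : ∃ F : Ac K, (∀ y, (F : K → ℝ) y = c + ∑ i ∈ s, a i * (f i : K → ℝ) y) ∧
      p F = c + ∑ i ∈ s, a i * p (f i) := by
  classical
  induction s using Finset.induction_on with
  | empty =>
    exact ⟨Ac.smul c hc (Ac.one K), fun y => by simp [Ac.smul_apply, Ac.one_apply],
      by simp [hsmul, hone]⟩
  | insert i s hi ih =>
    obtain ⟨F, hF, hpF⟩ := ih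
    refine ⟨Ac.add (Ac.smul (a i) (ha i) (f i)) F, fun y => ?_, ?_⟩
    · rw [Ac.add_apply, Ac.smul_apply, hF, Finset.sum_insert hi]; ring
    · rw [hadd, hsmul, hpF, Finset.sum_insert hi]; ring

/-- A monotone, additive, positively homogeneous and unital function on `A_c(K)` is the
evaluation at a point of `K`. -/
theorem exists_eq_eval (hK : IsCompact K) (hKc : Convex ℝ K)
    {p : Ac K → ℝ} (hadd : ∀ f g, p (Ac.add f g) = p f + p g)
    (hsmul : ∀ t ht f, p (Ac.smul t ht f) = t * p f) (hone : p (Ac.one K) = 1)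
    (hmono : ∀ f g : Ac K, (f : K → ℝ) ≤ (g : K → ℝ) → p f ≤ p g) :
    ∃ x : K, ∀ f : Ac K, (f : K → ℝ) x = p f := by
  classical
  have : CompactSpace K := isCompact_iff_compactSpace.mp hK
  suffices h : (⋂ f : Ac K, {y : K | (f : K → ℝ) y = p f}).Nonempty by
    obtain ⟨x, hx⟩ := h
    exact ⟨x, fun f => mem_iInter.1 hx f⟩
  -- Compactness leaves finitely many `f`, hence a separation in finite dimension.
  refine CompactSpace.iInter_nonempty
    (fun f : Ac K => isClosed_eq f.2.1.1 continuous_const) fun u => ?_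
  let ev : K → (u → ℝ) := fun y f => (f.1 : K → ℝ) y
  have hev : Continuous ev := continuous_pi fun f => f.1.2.1.1
  suffices h : (fun f : u => p f) ∈ range ev by
    obtain ⟨y, hy⟩ := h
    exact ⟨y, mem_iInter₂.2 fun f hf => congrFun hy ⟨f, hf⟩⟩
  by_contra hnot
  have hconv : Convex ℝ (range ev) := by
    rintro _ ⟨y, rfl⟩ _ ⟨z, rfl⟩ a b ha hb hab
    refine ⟨⟨a • (y : E) + b • (z : E), hKc y.2 z.2 ha hb hab⟩, funext fun f => ?_⟩
    exact f.1.2.1.2 y z _ a b ha hb hab rfl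
  obtain ⟨L, r, hLK, hLp⟩ :=
    geometric_hahn_banach_closed_point hconv (isCompact_range hev).isClosed hnot
  set d : u → ℝ := fun f => L (Pi.single f 1) with hd
  have hL : ∀ w : u → ℝ, L w = ∑ f, w f * d f := by
    intro w
    refine (LinearMap.pi_apply_eq_sum_univ L.toLinearMap w).trans (Finset.sum_congr rfl fun f _ => ?_)
    rw [show (fun j => if f = j then (1 : ℝ) else 0) = Pi.single f 1 from
      funext fun j => by simp [Pi.single_apply, eq_comm]]
    rfl
  -- `p` only sees positive combinations, so `∑ d f * f ≤ r` is rewritten as `F ≤ G` by adding `|d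
  -- f| + 1` to the coefficients and `|r| + 1` to the constant.
  have hapos : ∀ f, 0 < |d f| + 1 := fun f => by positivity
  have hbpos : ∀ f, 0 < |d f| + 1 - d f := fun f => by linarith [le_abs_self (d f)]
  have hc₁ : 0 < |r| + 1 := by positivity
  have hc₂ : 0 < |r| + 1 + r := by linarith [neg_abs_le r]
  obtain ⟨F, hF, hpF⟩ := exists_Ac_eq_const_add_sum hadd hsmul hone Finset.univ
    (fun f : u => f.1) hapos hc₁
  obtain ⟨G, hG, hpG⟩ := exists_Ac_eq_const_add_sum hadd hsmul hone Finset.univ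
    (fun f : u => f.1) hbpos hc₂
  have hsum : ∀ w : u → ℝ,
      ∑ f, (|d f| + 1) * w f = ∑ f, (|d f| + 1 - d f) * w f + L w := by
    intro w
    rw [hL, ← Finset.sum_add_distrib]
    exact Finset.sum_congr rfl fun f _ => by ring
  have hFG : (F : K → ℝ) ≤ (G : K → ℝ) := by
    intro y
    have h1 := hLK _ (mem_range_self y)
    have h2 := hsum (ev y)
    rw [hF, hG]
    simp only [ev] at h1 h2
    linarith
  have h1 := hmono F G hFG
  have h2 := hsum fun f => p f
  rw [hpF, hpG] at h1
  linarith

end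

section

variable {E E' : Type*} [AddCommGroup E] [Module ℝ E] [TopologicalSpace E]
  [AddCommGroup E'] [Module ℝ E'] [TopologicalSpace E'] {K : Set E} {K' : Set E'}

/-! ### From order isomorphism to point map. -/

/-- `Φ` preserves and reflects the relations `t g ≤ f` for `t > 0`. -/
def PreservesScaledOrder (Φ : Ac K ≃ Ac K') : Prop :=
  ∀ (t : ℝ) (f g : Ac K), 0 < t →
    (t • (Φ g : K' → ℝ) ≤ (Φ f : K' → ℝ) ↔ t • (g : K → ℝ) ≤ (f : K → ℝ))

theorem IsUnitalGaugePreserving.preservesScaledOrder {Φ : Ac K ≃ Ac K'}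
    (hΦ : IsUnitalGaugePreserving Φ) : PreservesScaledOrder Φ := by
  intro t f g ht
  have hiff : Nonempty K' ↔ Nonempty K := by
    rw [nonempty_iff_gauge_m_one_pos, nonempty_iff_gauge_m_one_pos, ← hΦ.2, hΦ.1]
  by_cases hne : Nonempty K
  · have := hiff.2 hne
    rw [← le_gauge_m_iff ht, ← le_gauge_m_iff ht, hΦ.1]
  · have hne' := hne
    rw [← hiff] at hne'
    rw [not_nonempty_iff] at hne hne'
    exact ⟨fun _ y => hne.elim y, fun _ y => hne'.elim y⟩

namespace PreservesScaledOrder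

variable {Φ : Ac K ≃ Ac K'}

theorem symm (hΦ : PreservesScaledOrder Φ) : PreservesScaledOrder Φ.symm := by
  intro t f g ht
  rw [← hΦ t _ _ ht, Φ.apply_symm_apply, Φ.apply_symm_apply]

theorem le_iff (hΦ : PreservesScaledOrder Φ) (f g : Ac K) :
    (Φ g : K' → ℝ) ≤ (Φ f : K' → ℝ) ↔ (g : K → ℝ) ≤ (f : K → ℝ) := by
  simpa using hΦ 1 f g one_pos

theorem map_smul (hΦ : PreservesScaledOrder Φ) {t : ℝ} (ht : 0 < t) (f : Ac K) :
    Φ (Ac.smul t ht f) = Ac.smul t ht (Φ f) := by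
  apply Subtype.ext
  refine le_antisymm (fun y => ?_) ((hΦ t _ f ht).2 le_rfl)
  have h : t⁻¹ • (Φ (Ac.smul t ht f) : K' → ℝ) ≤ (Φ f : K' → ℝ) := by
    refine (hΦ t⁻¹ _ _ (inv_pos.2 ht)).2 fun z => le_of_eq ?_
    simp only [Pi.smul_apply, Ac.smul_apply, smul_eq_mul]
    field_simp
  have := mul_le_mul_of_nonneg_left (h y) ht.le
  simpa only [Ac.smul_apply, Pi.smul_apply, smul_eq_mul, mul_inv_cancel_left₀ ht.ne'] using this

theorem map_add_le [IsTopologicalAddGroup E'] [ContinuousSMul ℝ E'] [LocallyConvexSpace ℝ E']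
    [T2Space E'] (hK' : IsCompact K') (hKc' : Convex ℝ K') (hΦ : PreservesScaledOrder Φ)
    (f₁ f₂ : Ac K) :
    (Φ (Ac.add f₁ f₂) : K' → ℝ) ≤ (Ac.add (Φ f₁) (Φ f₂) : K' → ℝ) := by
  refine le_of_restr_le hK' (Φ _).2.1 (Ac.add _ _).2.1 fun x => ?_
  let x' : K' := ⟨x, extremePoints_subset x.2⟩
  have ha₁ : 0 < (Φ f₁ : K' → ℝ) x' := (Φ f₁).2.2 x'
  have ha₂ : 0 < (Φ f₂ : K' → ℝ) x' := (Φ f₂).2.2 x'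
  change (Φ (Ac.add f₁ f₂) : K' → ℝ) x' ≤ (Φ f₁ : K' → ℝ) x' + (Φ f₂ : K' → ℝ) x'
  set a₁ := (Φ f₁ : K' → ℝ) x' with h₁
  set a₂ := (Φ f₂ : K' → ℝ) x' with h₂
  have key : ∀ c : ℝ, 1 < c → (Φ (Ac.add f₁ f₂) : K' → ℝ) x' ≤ (a₁ + a₂) * c := by
    intro c hc
    -- Dividing by `aᵢ` makes both values at `x` equal to 1, so one `g` serves both.
    obtain ⟨g, hgA, hg₁, hg₂, hgx⟩ := exists_A_ge_of_mem_extremePoints hK' hKc'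
      (smul_mem_A a₁⁻¹ (Φ f₁).2.1) (smul_mem_A a₂⁻¹ (Φ f₂).2.1) x
      (inv_mul_cancel₀ ha₁.ne') (inv_mul_cancel₀ ha₂.ne') hc
    let G : Ac K' := ⟨g, hgA, fun y =>
      (mul_pos (inv_pos.2 ha₁) ((Φ f₁).2.2 y)).trans_le (hg₁ y)⟩
    have hle : ∀ (a : ℝ) (f : Ac K), 0 < a → a⁻¹ • (Φ f : K' → ℝ) ≤ g →
        ∀ y, (f : K → ℝ) y ≤ a * (Φ.symm G : K → ℝ) y := by
      intro a f ha h y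
      have h' := (hΦ a⁻¹ (Φ.symm G) f (inv_pos.2 ha)).1 (by rwa [Φ.apply_symm_apply]) y
      simp only [Pi.smul_apply, smul_eq_mul] at h'
      rwa [inv_mul_le_iff₀ ha] at h'
    have hsum : (Ac.add f₁ f₂ : K → ℝ) ≤ (Ac.smul (a₁ + a₂) (add_pos ha₁ ha₂) (Φ.symm G) : K → ℝ) := by
      intro y
      rw [Ac.add_apply, Ac.smul_apply, add_mul]
      exact add_le_add (hle a₁ f₁ ha₁ hg₁ y) (hle a₂ f₂ ha₂ hg₂ y)
    have h := (hΦ.le_iff _ _).2 hsum x'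
    rw [hΦ.map_smul, Φ.apply_symm_apply, Ac.smul_apply] at h
    have hgx' : (G : K' → ℝ) x' = c := hgx
    rwa [hgx'] at h
  refine le_of_forall_pos_le_add fun ε hε => ?_
  have hpos := add_pos ha₁ ha₂
  refine (key (1 + ε / (a₁ + a₂)) (by have := div_pos hε hpos; linarith)).trans_eq ?_
  field_simp

variable [IsTopologicalAddGroup E] [ContinuousSMul ℝ E] [LocallyConvexSpace ℝ E] [T2Space E]
  [IsTopologicalAddGroup E'] [ContinuousSMul ℝ E'] [LocallyConvexSpace ℝ E'] [T2Space E']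

theorem map_add (hK : IsCompact K) (hKc : Convex ℝ K) (hK' : IsCompact K') (hKc' : Convex ℝ K')
    (hΦ : PreservesScaledOrder Φ) (f₁ f₂ : Ac K) :
    Φ (Ac.add f₁ f₂) = Ac.add (Φ f₁) (Φ f₂) := by
  refine Subtype.ext (le_antisymm (hΦ.map_add_le hK' hKc' f₁ f₂) ?_)
  have h := hΦ.symm.map_add_le hK hKc (Φ f₁) (Φ f₂)
  rw [Φ.symm_apply_apply, Φ.symm_apply_apply, ← hΦ.le_iff, Φ.apply_symm_apply] at h
  exact h

theorem exists_dual_map (hK : IsCompact K) (hKc : Convex ℝ K) (hK' : IsCompact K')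
    (hKc' : Convex ℝ K') (hΦ : PreservesScaledOrder Φ) (hone : Φ (Ac.one K) = Ac.one K') :
    ∃ T : K' → K, ∀ (f : Ac K) (x : K'), (f : K → ℝ) (T x) = (Φ f : K' → ℝ) x := by
  have h : ∀ x : K', ∃ y : K, ∀ f : Ac K, (f : K → ℝ) y = (Φ f : K' → ℝ) x := by
    intro x
    refine exists_eq_eval hK hKc (fun f g => ?_) (fun t ht f => ?_) ?_ fun f g hfg => ?_
    · rw [hΦ.map_add hK hKc hK' hKc', Ac.add_apply]
    · rw [hΦ.map_smul, Ac.smul_apply]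
    · rw [hone, Ac.one_apply]
    · exact (hΦ.le_iff _ _).2 hfg x
  choose T hT using h
  exact ⟨T, fun f x => hT x f⟩

theorem exists_dual_equiv (hK : IsCompact K) (hKc : Convex ℝ K) (hK' : IsCompact K')
    (hKc' : Convex ℝ K') (hΦ : PreservesScaledOrder Φ) (hone : Φ (Ac.one K) = Ac.one K') :
    ∃ e : K ≃ K', (∀ (f : Ac K) (x : K'), (f : K → ℝ) (e.symm x) = (Φ f : K' → ℝ) x) ∧
      ∀ (g : Ac K') (x : K), (g : K' → ℝ) (e x) = (Φ.symm g : K → ℝ) x := by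
  obtain ⟨T, hT⟩ := hΦ.exists_dual_map hK hKc hK' hKc' hone
  obtain ⟨S, hS⟩ := hΦ.symm.exists_dual_map hK' hKc' hK hKc (by rw [← hone, Φ.symm_apply_apply])
  refine ⟨⟨S, T, fun x => Ac.separatesPoints hK fun f => ?_,
    fun x => Ac.separatesPoints hK' fun g => ?_⟩, hT, hS⟩
  · rw [hT, hS, Φ.symm_apply_apply]
  · rw [hS, hT, Φ.apply_symm_apply]

end PreservesScaledOrder

/-! ### Passage to the extreme boundaries and back. -/

omit [TopologicalSpace E'] in
theorem map_mem_extremePoints [IsTopologicalAddGroup E] [ContinuousSMul ℝ E]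
    [LocallyConvexSpace ℝ E] [T2Space E] (hK : IsCompact K) (hKc : Convex ℝ K) (e : K ≃ K')
    (he : ∀ f : Ac K, IsAffine K' ((f : K → ℝ) ∘ e.symm)) {x : K}
    (hx : (x : E) ∈ K.extremePoints ℝ) : (e x : E') ∈ K'.extremePoints ℝ := by
  refine ⟨(e x).2, fun y hy z hz hyz => ?_⟩
  obtain ⟨a, b, ha, hb, hab, heq⟩ := hyz
  let w : K := ⟨a • (e.symm ⟨y, hy⟩ : E) + b • (e.symm ⟨z, hz⟩ : E),
    hKc (e.symm _).2 (e.symm _).2 ha.le hb.le hab⟩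
  -- Affinity of `e.symm` is only known through `Ac K`, which separates points.
  have hw : w = x := Ac.separatesPoints hK fun f => by
    have h := he f ⟨y, hy⟩ ⟨z, hz⟩ (e x) a b ha.le hb.le hab heq.symm
    simp only [Function.comp_apply, Equiv.symm_apply_apply] at h
    rw [h]
    exact f.2.1.2 _ _ w a b ha.le hb.le hab rfl
  have h := hx.2 (e.symm ⟨y, hy⟩).2 (e.symm ⟨z, hz⟩).2 ⟨a, b, ha, hb, hab, congrArg Subtype.val hw⟩
  have h' : e.symm ⟨y, hy⟩ = x := Subtype.ext h
  rw [← h', e.apply_symm_apply]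

theorem continuousAndExtends_restr {f : K → ℝ} (hf : f ∈ A K) :
    ContinuousAndExtends K (restr K f) :=
  ⟨hf.1.comp (continuous_subtype_val.subtype_mk _), f, hf, rfl⟩

theorem IsInducedBy.isAdmissible {Φ : Ac K ≃ Ac K'} {α : ExtBdry K ≃ ExtBdry K'}
    (h : IsInducedBy Φ α) : IsAdmissible α := fun f g =>
  ⟨h.2 g ▸ continuousAndExtends_restr (Φ.symm g).2.1,
    h.1 f ▸ continuousAndExtends_restr (Φ f).2.1⟩

variable [IsTopologicalAddGroup E] [ContinuousSMul ℝ E] [LocallyConvexSpace ℝ E] [T2Space E]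
  [IsTopologicalAddGroup E'] [ContinuousSMul ℝ E'] [LocallyConvexSpace ℝ E'] [T2Space E']

theorem IsUnitalGaugePreserving.exists_isInducedBy (hK : IsCompact K) (hKc : Convex ℝ K)
    (hK' : IsCompact K') (hKc' : Convex ℝ K') {Φ : Ac K ≃ Ac K'}
    (hΦ : IsUnitalGaugePreserving Φ) : ∃ α : ExtBdry K ≃ ExtBdry K', IsInducedBy Φ α := by
  obtain ⟨e, he, he'⟩ := hΦ.preservesScaledOrder.exists_dual_equiv hK hKc hK' hKc' hΦ.2
  have haff : ∀ f : Ac K, IsAffine K' ((f : K → ℝ) ∘ e.symm) := fun f => by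
    rw [show (f : K → ℝ) ∘ e.symm = (Φ f : K' → ℝ) from funext (he f)]
    exact (Φ f).2.1.2
  have haff' : ∀ g : Ac K', IsAffine K ((g : K' → ℝ) ∘ e) := fun g => by
    rw [show (g : K' → ℝ) ∘ e = (Φ.symm g : K → ℝ) from funext (he' g)]
    exact (Φ.symm g).2.1.2
  refine ⟨⟨fun x => ⟨e ⟨x, extremePoints_subset x.2⟩, map_mem_extremePoints hK hKc e haff x.2⟩,
    fun x => ⟨e.symm ⟨x, extremePoints_subset x.2⟩,
      map_mem_extremePoints hK' hKc' e.symm haff' x.2⟩,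
    fun x => ?_, fun x => ?_⟩, fun f => funext fun x => ?_, fun g => funext fun x => ?_⟩
  · simp
  · simp
  · exact (he f _).symm
  · exact (he' g _).symm

/-- A function on `∂ₑK` that is positive and extends to a continuous affine function on `K` is
the restriction of an element of `A_c(K)`. -/
theorem ContinuousAndExtends.exists_Ac (hK : IsCompact K) {u : ExtBdry K → ℝ}
    (hu : ContinuousAndExtends K u) (hpos : ∀ x, 0 < u x) :
    ∃ F : Ac K, restr K (F : K → ℝ) = u := by
  obtain ⟨-, h, hA, rfl⟩ := hu
  exact ⟨⟨h, hA, pos_of_restr_pos hK hA hpos⟩, rfl⟩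

theorem IsInducedBy.isUnitalGaugePreserving (hK : IsCompact K) (hK' : IsCompact K')
    {Φ : Ac K ≃ Ac K'} {α : ExtBdry K ≃ ExtBdry K'} (h : IsInducedBy Φ α) :
    IsUnitalGaugePreserving Φ := by
  constructor
  · intro f g
    -- Both orders can be tested on extreme points, so the two suprema run over the same set.
    have hiff : ∀ t : ℝ, t • (Φ g : K' → ℝ) ≤ (Φ f : K' → ℝ) ↔ t • (g : K → ℝ) ≤ (f : K → ℝ) := by
      refine fun t => ⟨fun hle => ?_, fun hle => ?_⟩
      · refine le_of_restr_le hK (smul_mem_A t g.2.1) f.2.1 fun x => ?_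
        have hf := congrFun (h.1 f) (α x)
        have hg := congrFun (h.1 g) (α x)
        simp only [Function.comp_apply, Equiv.symm_apply_apply] at hf hg
        have := hle ⟨α x, extremePoints_subset (α x).2⟩
        change t * restr K' (Φ g : K' → ℝ) (α x) ≤ restr K' (Φ f : K' → ℝ) (α x) at this
        rwa [hf, hg] at this
      · refine le_of_restr_le hK' (smul_mem_A t (Φ g).2.1) (Φ f).2.1 fun x => ?_
        change t * restr K' (Φ g : K' → ℝ) x ≤ _
        rw [h.1 f, h.1 g]
        exact hle ⟨α.symm x, extremePoints_subset (α.symm x).2⟩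
    simp only [gauge_m, hiff]
  · exact Subtype.ext (eq_of_restr_eq hK' (Φ _).2.1 (Ac.one K').2.1 (h.1 _))

theorem IsAdmissible.exists_isInducedBy (hK : IsCompact K) (hK' : IsCompact K')
    {α : ExtBdry K ≃ ExtBdry K'} (hα : IsAdmissible α) :
    ∃ Φ : Ac K ≃ Ac K', IsInducedBy Φ α := by
  have h₁ : ∀ f : Ac K, ∃ F : Ac K', restr K' (F : K' → ℝ) = restr K (f : K → ℝ) ∘ α.symm :=
    fun f => (hα f (Ac.one K')).2.exists_Ac hK' fun x => f.2.2 _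
  have h₂ : ∀ g : Ac K', ∃ G : Ac K, restr K (G : K → ℝ) = restr K' (g : K' → ℝ) ∘ α :=
    fun g => (hα (Ac.one K) g).1.exists_Ac hK fun x => g.2.2 _
  choose P hP using h₁
  choose Q hQ using h₂
  refine ⟨⟨P, Q, fun f => Subtype.ext (eq_of_restr_eq hK (Q _).2.1 f.2.1 ?_),
    fun g => Subtype.ext (eq_of_restr_eq hK' (P _).2.1 g.2.1 ?_)⟩, hP, hQ⟩
  · rw [hQ, hP, Function.comp_assoc, Equiv.symm_comp_self, Function.comp_id]
  · rw [hP, hQ, Function.comp_assoc, Equiv.self_comp_symm, Function.comp_id]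

end

end GaugeCone

theorem mainTheorem2
    {E E' : Type*}
    [AddCommGroup E] [Module ℝ E] [TopologicalSpace E] [IsTopologicalAddGroup E]
    [ContinuousSMul ℝ E] [LocallyConvexSpace ℝ E] [T2Space E]
    [AddCommGroup E'] [Module ℝ E'] [TopologicalSpace E'] [IsTopologicalAddGroup E']
    [ContinuousSMul ℝ E'] [LocallyConvexSpace ℝ E'] [T2Space E']
    (K : Set E) (K' : Set E')
    (hK : IsCompact K) (hKc : Convex ℝ K) (hK' : IsCompact K') (hKc' : Convex ℝ K') :
    ((∃ Φ : GaugeCone.Ac K ≃ GaugeCone.Ac K', GaugeCone.IsUnitalGaugePreserving Φ) ↔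
      ∃ α : GaugeCone.ExtBdry K ≃ GaugeCone.ExtBdry K', GaugeCone.IsAdmissible α) ∧
    (∀ Φ : GaugeCone.Ac K ≃ GaugeCone.Ac K', GaugeCone.IsUnitalGaugePreserving Φ →
      ∃ α : GaugeCone.ExtBdry K ≃ GaugeCone.ExtBdry K',
        GaugeCone.IsAdmissible α ∧ GaugeCone.IsInducedBy Φ α) ∧
    (∀ α : GaugeCone.ExtBdry K ≃ GaugeCone.ExtBdry K', GaugeCone.IsAdmissible α →
      ∃! Φ : GaugeCone.Ac K ≃ GaugeCone.Ac K',
        GaugeCone.IsUnitalGaugePreserving Φ ∧ GaugeCone.IsInducedBy Φ α) := by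
  have forward : ∀ Φ : GaugeCone.Ac K ≃ GaugeCone.Ac K', GaugeCone.IsUnitalGaugePreserving Φ →
      ∃ α : GaugeCone.ExtBdry K ≃ GaugeCone.ExtBdry K',
        GaugeCone.IsAdmissible α ∧ GaugeCone.IsInducedBy Φ α := fun Φ hΦ => by
    obtain ⟨α, hα⟩ := hΦ.exists_isInducedBy hK hKc hK' hKc'
    exact ⟨α, hα.isAdmissible, hα⟩
  have backward : ∀ α : GaugeCone.ExtBdry K ≃ GaugeCone.ExtBdry K', GaugeCone.IsAdmissible α →
      ∃! Φ : GaugeCone.Ac K ≃ GaugeCone.Ac K',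
        GaugeCone.IsUnitalGaugePreserving Φ ∧ GaugeCone.IsInducedBy Φ α := fun α hα => by
    obtain ⟨Φ, hΦ⟩ := hα.exists_isInducedBy hK hK'
    refine ⟨Φ, ⟨hΦ.isUnitalGaugePreserving hK hK', hΦ⟩, fun Ψ hΨ => Equiv.ext fun f =>
      Subtype.ext (GaugeCone.eq_of_restr_eq hK' (Ψ f).2.1 (Φ f).2.1 ?_)⟩
    rw [hΨ.2.1, hΦ.1]
  refine ⟨⟨fun ⟨Φ, hΦ⟩ => ?_, fun ⟨α, hα⟩ => ?_⟩, forward, backward⟩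
  · obtain ⟨α, hα, -⟩ := forward Φ hΦ
    exact ⟨α, hα⟩
  · obtain ⟨Φ, hΦ, -⟩ := backward α hα
    exact ⟨Φ, hΦ.1⟩
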